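/- Let $\mathcal{E}$ be the ellipse $x^2/a^2+y^2/b^2=1$ with $a>b>0$, and put $c^2=a^2-b^2$. Let $\mathcal{K}$ be a circle of positive radius centered at $C=[x_c,y_c]$, nested in the interior of $\mathcal{E}$, such that $(\mathcal{E},\mathcal{K})$ admits Poncelet triangles, i.e. triangles with vertices on $\mathcal{E}$ and side lines tangent to $\mathcal{K}$. Let $\mathcal{L}_3$ be the locus of the circumcenter $X_3$ over all these Poncelet triangles. Then $\mathcal{L}_3$ is an ellipse (possibly a circle, whose foci are taken to coincide with its center). Its foci are \[ F_3=\left[x_c\left(1-(b/a)^2\right),\,0\right],\qquad F_3'=\left[0,\,y_c\left(1-(a/b)^2\right)\right], \] so that each of them lies on an axis of $\mathcal{E}$, and $F_3,F_3',C$ are collinear. The major and minor semi-axis lengths $a_3\ge b_3>0$ of $\mathcal{L}_3$ are \[ a_3=\delta_3\,\frac{a}{b}-\delta_3'\,\frac{b}{a},\qquad b_3=\delta_3'-\delta_3,\qquad\text{where}\quad \delta_3=\frac{\sqrt{b^4+c^2y_c^2}}{2b},\quad \delta_3'=\frac{\sqrt{a^4-c^2x_c^2}}{2a}. \] -/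

import Mathlib

/-- The Euclidean plane. -/
abbrev Plane : Type := EuclideanSpace ℝ (Fin 2)

/-- The axis-aligned ellipse centered at the origin with semi-axis lengths `a` (along the first
coordinate axis) and `b` (along the second one). -/
def outerEllipse (a b : ℝ) : Set Plane :=
  {P | (P 0 / a) ^ 2 + (P 1 / b) ^ 2 = 1}

/-- The open region bounded by `outerEllipse a b`. -/
def outerEllipseInterior (a b : ℝ) : Set Plane :=
  {P | (P 0 / a) ^ 2 + (P 1 / b) ^ 2 < 1}

/-- `T` is a (nondegenerate) triangle interscribed between `outerEllipse a b` and the circle `K`: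
its vertices lie on the ellipse and its side lines are tangent to the circle. -/
structure IsPonceletTriangle (a b : ℝ) (K : EuclideanGeometry.Sphere Plane)
    (T : Affine.Triangle ℝ Plane) : Prop where
  inscribed : ∀ i, T.points i ∈ outerEllipse a b
  circumscribed : ∀ i j, i ≠ j → K.IsTangent (line[ℝ, T.points i, T.points j])

/-- `K` is a circular caustic of Poncelet triangles inscribed in `outerEllipse a b`: it is a
circle of positive radius, nested inside the ellipse, and a triangle is interscribed between
the two curves. -/
structure IsCircularCaustic (a b : ℝ) (K : EuclideanGeometry.Sphere Plane) : Prop where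
  radius_pos : 0 < K.radius
  nested : Metric.closedBall K.center K.radius ⊆ outerEllipseInterior a b
  closes : ∃ T : Affine.Triangle ℝ Plane, IsPonceletTriangle a b K T

/-- The locus of the circumcenter over all the Poncelet triangles interscribed between
`outerEllipse a b` and the circle `K`. -/
def circumcenterLocus (a b : ℝ) (K : EuclideanGeometry.Sphere Plane) : Set Plane :=
  {P | ∃ T : Affine.Triangle ℝ Plane, IsPonceletTriangle a b K T ∧ T.circumcenter = P}

/-- `L` is the (nondegenerate) ellipse with foci `F`, `F'`, major semi-axis length `p` and minor
semi-axis length `q`. A circle is allowed (`F = F'`, `p = q`). -/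
structure IsEllipseWith (L : Set Plane) (F F' : Plane) (p q : ℝ) : Prop where
  minor_pos : 0 < q
  minor_le_major : q ≤ p
  focal_distance : (dist F F' / 2) ^ 2 = p ^ 2 - q ^ 2
  eq_locus : L = {P | dist P F + dist P F' = 2 * p}

/-! The affine map taking the ellipse to the unit circle sends the center of the caustic to `m` and
the caustic to an ellipse with foci `f, g = m ± √H * I`. Tangency of a chord becomes the polynomial
equation `chordForm = 0`. For three chords these equations amount to two facts
(`sum_eq_of_chordForm_eq_zero`, with converse `chordForm_eq_zero_of_sum_eq`): the parameters of the
vertices solve the Blaschke equation `z(z - f)(z - g) = l(1 - conj f z)(1 - conj g z)`, where `l` is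
their product, and a closing condition holds that does not involve `l`. Nesting puts `f, g` in the
unit disk, so every unimodular `l` gives three unimodular roots. They are distinct because no
tangent of the outer ellipse touches the caustic. Hence the triangles are parametrized by `l`
(`exists_isPonceletTriangle`).

The circumcenter is real-linear in the sum and the product of the parameters, so it has the form `O
+ α l + β conj l`. As `l` runs over the unit circle this traces an ellipse with semi-axes `‖α‖ ±
‖β‖` and foci `O ± φ`, where `φ ^ 2 = 4αβ` (`norm_sub_add_norm_add_eq_iff`). The closing condition
makes `‖α‖`, `‖β‖` and `φ` explicit. Moreover `φ = conj O`, so one focus is real and the other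
purely imaginary. -/

open Complex ComplexConjugate

/-! ### Tangent chords and the Blaschke equation -/

/-- The affine parametrization of `outerEllipse a b` by the unit circle of the complex plane. -/
noncomputable def ellipsePoint (a b : ℝ) (z : ℂ) : Plane := !₂[a * z.re, b * z.im]

/-- For `z`, `w` on the unit circle, this vanishes if and only if the chord of the ellipse joining
the points with parameters `z` and `w` is tangent to the circle whose center has parameter `m` and
whose squared radius `ρ` is encoded in `H = ρ / b² - ρ / a²` and `k = ρ / a² + ρ / b²`. -/
noncomputable def chordForm (m : ℂ) (H k : ℝ) (z w : ℂ) : ℂ :=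
  (m + z * w * conj m - z - w) ^ 2 + H * (1 + (z * w) ^ 2) - 2 * (z * w) * k

theorem chordForm_comm (m : ℂ) (H k : ℝ) (z w : ℂ) :
    chordForm m H k z w = chordForm m H k w z := by
  unfold chordForm; ring

/-- A quadratic polynomial with three distinct zeros vanishes identically. -/
theorem quadratic_coeffs_eq_zero {F : Type*} [Field F] {A B C x y z : F} (hxy : x ≠ y)
    (hxz : x ≠ z) (hyz : y ≠ z) (hx : A * x ^ 2 + B * x + C = 0)
    (hy : A * y ^ 2 + B * y + C = 0) (hz : A * z ^ 2 + B * z + C = 0) :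
    A = 0 ∧ B = 0 ∧ C = 0 := by
  have h1 : A * (x + y) + B = 0 :=
    mul_left_cancel₀ (sub_ne_zero.2 hxy) (by linear_combination hx - hy)
  have h2 : A * (x + z) + B = 0 :=
    mul_left_cancel₀ (sub_ne_zero.2 hxz) (by linear_combination hx - hz)
  have hA : A = 0 := mul_left_cancel₀ (sub_ne_zero.2 hyz) (by linear_combination h1 - h2)
  have hB : B = 0 := by simpa [hA] using h1
  exact ⟨hA, hB, by simpa [hA, hB] using hx⟩

theorem conj_mul_self_of_norm_eq_one {z : ℂ} (hz : ‖z‖ = 1) : conj z * z = 1 := by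
  rw [Complex.conj_mul', hz]; norm_num

theorem mul_conj_self_of_norm_eq_one {z : ℂ} (hz : ‖z‖ = 1) : z * conj z = 1 := by
  rw [Complex.mul_conj', hz]; norm_num

/-- The vertices of a Poncelet triangle are the solutions of a Blaschke product equation. -/
theorem sum_eq_of_chordForm_eq_zero {m : ℂ} {H k : ℝ} {z₁ z₂ z₃ : ℂ} (h₁ : ‖z₁‖ = 1)
    (h₂ : ‖z₂‖ = 1) (h₃ : ‖z₃‖ = 1) (h₁₂ : z₁ ≠ z₂) (h₁₃ : z₁ ≠ z₃) (h₂₃ : z₂ ≠ z₃)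
    (q₁₂ : chordForm m H k z₁ z₂ = 0) (q₁₃ : chordForm m H k z₁ z₃ = 0)
    (q₂₃ : chordForm m H k z₂ z₃ = 0) :
    z₁ + z₂ + z₃ = 2 * m + conj (m ^ 2 + H) * (z₁ * z₂ * z₃) ∧
      1 + (m ^ 2 + H) * conj (m ^ 2 + H) = 2 * k + 2 * (m * conj m) := by
  have c₁ := conj_mul_self_of_norm_eq_one h₁
  have c₂ := conj_mul_self_of_norm_eq_one h₂
  have c₃ := conj_mul_self_of_norm_eq_one h₃
  have n₁ : z₁ ≠ 0 := by rintro rfl; simp at h₁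
  have n₂ : z₂ ≠ 0 := by rintro rfl; simp at h₂
  have n₃ : z₃ ≠ 0 := by rintro rfl; simp at h₃
  unfold chordForm at q₁₂ q₁₃ q₂₃
  obtain ⟨s, hs⟩ : ∃ s, s = z₁ + z₂ + z₃ := ⟨_, rfl⟩
  obtain ⟨t, ht⟩ : ∃ t, t = z₁ * z₂ + z₁ * z₃ + z₂ * z₃ := ⟨_, rfl⟩
  obtain ⟨p, hp⟩ : ∃ p, p = z₁ * z₂ * z₃ := ⟨_, rfl⟩
  have np : p ≠ 0 := by rw [hp]; exact mul_ne_zero (mul_ne_zero n₁ n₂) n₃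
  -- On the unit circle `conj zᵢ` is the inverse of `zᵢ`.
  have hts : t = p * conj s := by
    rw [ht, hp, hs]; simp only [map_add]
    linear_combination (-z₂ * z₃) * c₁ - z₁ * z₃ * c₂ - z₁ * z₂ * c₃
  -- With `z₂ * z₃ = p / z₁` and `z₂ + z₃ = s - z₁`, the product `z₁ ^ 2 * chordForm m H k z₂ z₃` is
  -- a quartic in `z₁`, and symmetrically for the other vertices. `A`, `B`, `C` are the coefficients
  -- of its remainder modulo the cubic with roots `zᵢ`. `C = 0` gives the sum, then `B = 0` the
  -- closing condition.
  obtain ⟨-, hB, hC⟩ := quadratic_coeffs_eq_zero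
    (A := (m - s) ^ 2 + 2 * conj m * p + H - (t - (2 * m - s) * s))
    (B := 2 * (m - s) * conj m * p - 2 * k * p - (-p + (2 * m - s) * t))
    (C := p ^ 2 * (conj m ^ 2 + H) + (2 * m - s) * p) h₁₂ h₁₃ h₂₃
    (by subst hs ht hp; linear_combination z₁ ^ 2 * q₂₃)
    (by subst hs ht hp; linear_combination z₂ ^ 2 * q₁₃)
    (by subst hs ht hp; linear_combination z₃ ^ 2 * q₁₂)
  have hvc : conj (m ^ 2 + H) = conj m ^ 2 + H := by simp
  have hsum : s = 2 * m + (conj m ^ 2 + H) * p :=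
    mul_left_cancel₀ np (by linear_combination -hC)
  have hsc : conj s = 2 * conj m + (m ^ 2 + H) * conj p := by rw [hsum]; simp [Complex.conj_ofNat]
  have hpp : p * conj p = 1 := by
    rw [hp]; simp only [map_mul]
    linear_combination z₂ * conj z₂ * z₃ * conj z₃ * c₁ + z₃ * conj z₃ * c₂ + c₃
  refine ⟨by rw [← hs, ← hp, hvc]; exact hsum, ?_⟩
  rw [hvc]
  have ht' : t = 2 * conj m * p + (m ^ 2 + H) := by
    rw [hts, hsc]; linear_combination (m ^ 2 + (H : ℂ)) * hpp
  refine mul_left_cancel₀ np ?_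
  rw [ht'] at hB
  have e : 2 * m - s = -(conj m ^ 2 + H) * p := by rw [hsum]; ring
  rw [e] at hB
  rw [hsum] at hB
  linear_combination hB

/-- The quartic `z ^ 2 * chordForm m H k x y` in the third root `z` is a multiple of the Blaschke
cubic plus `l * z` times the defect of the closing condition. -/
theorem chordForm_eq_zero_of_sum_eq {m : ℂ} {H k : ℝ} {x y z l : ℂ} (hz : z ≠ 0)
    (hsum : x + y + z = 2 * m + conj (m ^ 2 + H) * l)
    (hprod : x * y * z = l)
    (hcub : z ^ 3 - (2 * m + conj (m ^ 2 + H) * l) * z ^ 2 +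
      (m ^ 2 + H + 2 * conj m * l) * z - l = 0)
    (hC : 1 + (m ^ 2 + H) * conj (m ^ 2 + H) = 2 * k + 2 * (m * conj m)) :
    chordForm m H k x y = 0 := by
  have hvc : conj (m ^ 2 + H) = conj m ^ 2 + H := by simp
  rw [hvc] at hsum hcub hC
  have hxy : x + y = 2 * m + (conj m ^ 2 + H) * l - z := by linear_combination hsum
  have e : z ^ 2 * chordForm m H k x y =
      (m * z + l * conj m - (x + y) * z) ^ 2 + H * (z ^ 2 + l ^ 2) - 2 * l * z * k := by
    subst hprod; unfold chordForm; ring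
  rw [hxy] at e
  refine (mul_eq_zero.1 (?_ : z ^ 2 * chordForm m H k x y = 0)).resolve_left (pow_ne_zero _ hz)
  rw [e]
  linear_combination (z - (conj m ^ 2 + H) * l) * hcub + l * z * hC

/-! ### Roots of the Blaschke equation -/

theorem exists_roots_of_cubic (B C D : ℂ) :
    ∃ x y z : ℂ, ∀ w, w ^ 3 + B * w ^ 2 + C * w + D = (w - x) * (w - y) * (w - z) := by
  let P : Cubic ℂ := ⟨1, B, C, D⟩
  have ha : P.a ≠ 0 := one_ne_zero
  obtain ⟨x, y, z, h⟩ := (Cubic.splits_iff_roots_eq_three (φ := RingHom.id ℂ) ha).1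
    (IsAlgClosed.splits _)
  refine ⟨x, y, z, fun w => ?_⟩
  have := congrArg (Polynomial.eval w) (Cubic.eq_prod_three_roots ha h)
  simpa [Cubic.toPoly, Cubic.map, P] using this

/-- For `f` in the unit disk, this makes the Blaschke factor `(z - f) / (1 - conj f * z)` smaller
than 1 in modulus inside the disk and larger than 1 outside. -/
theorem normSq_one_sub_conj_mul_sub (f z : ℂ) :
    normSq (1 - conj f * z) - normSq (z - f) = (1 - normSq z) * (1 - normSq f) := by
  simp [normSq_apply]; ring

/-- The solutions of a Blaschke product equation lie on the unit circle. -/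
theorem norm_eq_one_of_blaschke {f g l z : ℂ} (hf : normSq f < 1) (hg : normSq g < 1)
    (hl : ‖l‖ = 1)
    (h : z * ((z - f) * (z - g)) = l * ((1 - conj f * z) * (1 - conj g * z))) : ‖z‖ = 1 := by
  have hl' : normSq l = 1 := by rw [normSq_eq_norm_sq, hl]; norm_num
  have hn := congrArg normSq h
  simp only [normSq_mul, hl', one_mul] at hn
  have e₁ := normSq_one_sub_conj_mul_sub f z
  have e₂ := normSq_one_sub_conj_mul_sub g z
  have p₁ := normSq_nonneg (z - f)
  have p₂ := normSq_nonneg (z - g)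
  have q₁ := normSq_nonneg (1 - conj f * z)
  have q₂ := normSq_nonneg (1 - conj g * z)
  have hz := normSq_nonneg z
  suffices normSq z = 1 by rw [normSq_eq_norm_sq] at this; nlinarith [norm_nonneg z]
  rcases lt_trichotomy (normSq z) 1 with h1 | h1 | h1
  · have d₁ : normSq (z - f) < normSq (1 - conj f * z) := by nlinarith
    have d₂ : normSq (z - g) < normSq (1 - conj g * z) := by nlinarith
    have := mul_lt_mul'' d₁ d₂ p₁ p₂
    nlinarith [mul_nonneg p₁ p₂]
  · exact h1
  · have d₁ : normSq (1 - conj f * z) < normSq (z - f) := by nlinarith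
    have d₂ : normSq (1 - conj g * z) < normSq (z - g) := by nlinarith
    have := mul_lt_mul'' d₁ d₂ q₁ q₂
    nlinarith [mul_nonneg p₁ p₂]

/-! ### Tangency in coordinates -/

theorem Plane.dist_sq (P Q : Plane) : dist P Q ^ 2 = (P 0 - Q 0) ^ 2 + (P 1 - Q 1) ^ 2 := by
  rw [EuclideanSpace.dist_eq, Real.sq_sqrt (by positivity)]
  simp [Fin.sum_univ_two, Real.dist_eq, sq_abs]

theorem Plane.ext {P Q : Plane} (h₀ : P 0 = Q 0) (h₁ : P 1 = Q 1) : P = Q := by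
  ext i; fin_cases i <;> assumption

/-- A line is tangent to a circle if and only if its distance to the center is the radius. -/
theorem isTangent_line_iff {C P Q : Plane} {r : ℝ} (hr : 0 < r) (hPQ : P ≠ Q) :
    (⟨C, r⟩ : EuclideanGeometry.Sphere Plane).IsTangent (line[ℝ, P, Q]) ↔
      ((P 0 - C 0) * (Q 1 - P 1) - (P 1 - C 1) * (Q 0 - P 0)) ^ 2 =
        r ^ 2 * ((Q 0 - P 0) ^ 2 + (Q 1 - P 1) ^ 2) := by
  have hd : 0 < (Q 0 - P 0) ^ 2 + (Q 1 - P 1) ^ 2 := by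
    have := Plane.dist_sq Q P
    rw [← this]
    exact pow_pos (dist_pos.2 hPQ.symm) 2
  constructor
  · rintro ⟨p, hp⟩
    obtain ⟨t, rfl⟩ := mem_affineSpan_pair_iff_exists_lineMap_eq.1 hp.mem_space
    have hs := Plane.dist_sq (AffineMap.lineMap P Q t) C
    have hm : dist (AffineMap.lineMap P Q t) C = r := hp.mem_sphere
    rw [hm] at hs
    have h1 := hp.inner_left_eq_zero_of_mem (left_mem_affineSpan_pair ℝ P Q)
    have h2 := hp.inner_left_eq_zero_of_mem (right_mem_affineSpan_pair ℝ P Q)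
    have h3 : inner ℝ (Q - P) (AffineMap.lineMap P Q t - C) = 0 := by
      simp only [vsub_eq_sub] at h1 h2
      rw [← sub_sub_sub_cancel_right Q P (AffineMap.lineMap P Q t), inner_sub_left, h1, h2, sub_zero]
    simp [PiLp.inner_apply, Fin.sum_univ_two, AffineMap.lineMap_apply] at h3 hs
    rw [hs]
    linear_combination -((t * (Q 0 - P 0) + P 0 - C 0) * (Q 0 - P 0) +
      (t * (Q 1 - P 1) + P 1 - C 1) * (Q 1 - P 1)) * h3
  · intro h
    -- `t` is the parameter of the foot of the perpendicular from `C`.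
    obtain ⟨t, ht⟩ : ∃ t : ℝ, t * ((Q 0 - P 0) ^ 2 + (Q 1 - P 1) ^ 2) =
        -((P 0 - C 0) * (Q 0 - P 0) + (P 1 - C 1) * (Q 1 - P 1)) :=
      ⟨_, div_mul_cancel₀ _ hd.ne'⟩
    have hin : inner ℝ (Q - P) (AffineMap.lineMap P Q t - C) = 0 := by
      simp [PiLp.inner_apply, Fin.sum_univ_two, AffineMap.lineMap_apply]
      linear_combination ht
    refine ⟨AffineMap.lineMap P Q t, ?_, AffineMap.lineMap_mem_affineSpan_pair _ _ _, ?_⟩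
    · show dist (AffineMap.lineMap P Q t) C = r
      have hs := Plane.dist_sq (AffineMap.lineMap P Q t) C
      simp [AffineMap.lineMap_apply] at hs
      rw [← sq_eq_sq₀ dist_nonneg hr.le]
      refine mul_right_cancel₀ hd.ne' ?_
      simp only [AffineMap.lineMap_apply, vsub_eq_sub, vadd_eq_add]
      rw [hs, ← h]
      linear_combination (t * ((Q 0 - P 0) ^ 2 + (Q 1 - P 1) ^ 2) +
        ((P 0 - C 0) * (Q 0 - P 0) + (P 1 - C 1) * (Q 1 - P 1))) * ht
    · intro x hx
      obtain ⟨u, rfl⟩ := mem_affineSpan_pair_iff_exists_lineMap_eq.1 hx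
      rw [EuclideanGeometry.Sphere.mem_orthRadius_iff_inner_left]
      have : (AffineMap.lineMap P Q u : Plane) - AffineMap.lineMap P Q t = (u - t) • (Q - P) := by
        simp only [AffineMap.lineMap_apply, vsub_eq_sub, vadd_eq_add]; module
      simp only [vsub_eq_sub]
      rw [this, inner_smul_left, hin, mul_zero]

theorem ofReal_re_eq (z : ℂ) : (z.re : ℂ) = (z + conj z) / 2 := Complex.re_eq_add_conj z
theorem ofReal_im_eq (z : ℂ) : (z.im : ℂ) = -(I * (z - conj z)) / 2 := by
  rw [Complex.im_eq_sub_conj, div_eq_div_iff (by simp) two_ne_zero]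
  linear_combination (2 * (z - conj z)) * I_sq

/-- The squared distance from the center of the caustic to a chord, compared with its radius. -/
theorem chordForm_identity {a b : ℝ} (ha : a ≠ 0) (hb : b ≠ 0) (m : ℂ) (r : ℝ) {z w : ℂ}
    (hz : ‖z‖ = 1) (hw : ‖w‖ = 1) :
    4 * (z * w) ^ 2 * (((a * z.re - a * m.re) * (b * w.im - b * z.im) -
        (b * z.im - b * m.im) * (a * w.re - a * z.re)) ^ 2 -
        r ^ 2 * ((a * w.re - a * z.re) ^ 2 + (b * w.im - b * z.im) ^ 2) : ℝ) =
      -(a * b) ^ 2 * (w - z) ^ 2 *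
        chordForm m (r ^ 2 / b ^ 2 - r ^ 2 / a ^ 2) (r ^ 2 / a ^ 2 + r ^ 2 / b ^ 2) z w := by
  have cz := mul_conj_self_of_norm_eq_one hz
  have cw := mul_conj_self_of_norm_eq_one hw
  -- After conjugates are cleared, both coordinate differences and the cross product contain the
  -- factor `w - z`, whence the square of it in the identity.
  have hx : 2 * (z * w) * ((w.re : ℂ) - z.re) = (w - z) * (z * w - 1) := by
    rw [ofReal_re_eq, ofReal_re_eq]; linear_combination z * cw - w * cz
  have hy : 2 * (z * w) * ((w.im : ℂ) - z.im) = -I * ((w - z) * (z * w + 1)) := by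
    rw [ofReal_im_eq, ofReal_im_eq]; linear_combination I * z * cw - I * w * cz
  have hc : 2 * (z * w) * (((z.re : ℂ) - m.re) * (w.im - z.im) -
      (z.im - m.im) * (w.re - z.re)) = -I * ((w - z) * (z + w - conj m * z * w - m)) := by
    have e : 2 * (z * w) * (((z.re : ℂ) - m.re) * (w.im - z.im) -
      (z.im - m.im) * (w.re - z.re)) = ((z.re : ℂ) - m.re) * (2 * (z * w) * (w.im - z.im)) -
      (z.im - m.im) * (2 * (z * w) * (w.re - z.re)) := by ring
    rw [e, hx, hy, ofReal_re_eq z, ofReal_im_eq z, ofReal_re_eq m, ofReal_im_eq m]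
    linear_combination (-I * (w - z) * w) * cz
  have ha' : (a : ℂ) ≠ 0 := by exact_mod_cast ha
  have hb' : (b : ℂ) ≠ 0 := by exact_mod_cast hb
  have hI := I_sq
  unfold chordForm
  push_cast
  have e : 4 * (z * w) ^ 2 * (((a * z.re - a * m.re) * (b * w.im - b * z.im) -
        (b * z.im - b * m.im) * (a * w.re - a * z.re)) ^ 2 -
        r ^ 2 * ((a * w.re - a * z.re) ^ 2 + (b * w.im - b * z.im) ^ 2) : ℂ) =
      (a * b) ^ 2 * (2 * (z * w) * (((z.re : ℂ) - m.re) * (w.im - z.im) -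
      (z.im - m.im) * (w.re - z.re))) ^ 2 - r ^ 2 * (a ^ 2 * (2 * (z * w) * (w.re - z.re)) ^ 2 +
      b ^ 2 * (2 * (z * w) * (w.im - z.im)) ^ 2) := by ring
  rw [e, hx, hy, hc]
  field_simp
  rw [hI]
  ring

theorem isTangent_chord_iff {a b xc yc r : ℝ} (ha : 0 < a) (hb : 0 < b) (hr : 0 < r) {z w : ℂ}
    (hz : ‖z‖ = 1) (hw : ‖w‖ = 1) (hzw : z ≠ w) :
    (⟨!₂[xc, yc], r⟩ : EuclideanGeometry.Sphere Plane).IsTangent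
        (line[ℝ, ellipsePoint a b z, ellipsePoint a b w]) ↔
      chordForm ⟨xc / a, yc / b⟩ (r ^ 2 / b ^ 2 - r ^ 2 / a ^ 2) (r ^ 2 / a ^ 2 + r ^ 2 / b ^ 2)
        z w = 0 := by
  have hne : ellipsePoint a b z ≠ ellipsePoint a b w := by
    intro h
    have h0 := congrArg (fun P : Plane => P 0) h
    have h1 := congrArg (fun P : Plane => P 1) h
    simp [ellipsePoint, ha.ne', hb.ne'] at h0 h1
    exact hzw (Complex.ext h0 h1)
  have nz : z ≠ 0 := by rintro rfl; simp at hz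
  have nw : w ≠ 0 := by rintro rfl; simp at hw
  rw [isTangent_line_iff hr hne, ← sub_eq_zero]
  have key := chordForm_identity ha.ne' hb.ne' ⟨xc / a, yc / b⟩ r hz hw
  have h4 : 4 * (z * w) ^ 2 ≠ 0 := by simp [nz, nw]
  have h5 : -((a : ℂ) * b) ^ 2 * (w - z) ^ 2 ≠ 0 := by
    simp [ha.ne', hb.ne', sub_ne_zero.2 hzw.symm]
  rw [← mul_eq_zero_iff_left h5, ← key, mul_eq_zero_iff_left h4, ofReal_eq_zero]
  simp only [ellipsePoint, mul_div_cancel₀ _ ha.ne', mul_div_cancel₀ _ hb.ne']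
  simp

/-! ### The circumcenter of an inscribed triangle -/

/-- The candidate circumcenter of the triangle inscribed in `outerEllipse a b` whose vertices have
parameters with sum `s` and product `l`. -/
noncomputable def circumcenterPoint (a b : ℝ) (s l : ℂ) : Plane :=
  !₂[(a ^ 2 - b ^ 2) / (4 * a) * (s + l).re, -((a ^ 2 - b ^ 2) / (4 * b) * (s - l).im)]

/-- A circle meets the ellipse at the roots of a quartic in the parameter whose product is 1, so the
fourth root is `conj (x * y * z)`. The sum of the four roots determines the center, which explains
the formula for `circumcenterPoint`. -/
theorem dist_circumcenterPoint_eq {a b : ℝ} (ha : 0 < a) (hb : 0 < b) {x y z : ℂ} (hx : ‖x‖ = 1)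
    (hy : ‖y‖ = 1) (hz : ‖z‖ = 1) :
    dist (ellipsePoint a b x) (circumcenterPoint a b (x + y + z) (x * y * z)) =
      dist (ellipsePoint a b y) (circumcenterPoint a b (x + y + z) (x * y * z)) := by
  rw [← sq_eq_sq₀ dist_nonneg dist_nonneg, Plane.dist_sq, Plane.dist_sq, ← ofReal_inj]
  simp only [ellipsePoint, circumcenterPoint]
  simp only [Matrix.cons_val_zero, Matrix.cons_val_one]
  push_cast
  simp only [ofReal_re_eq, ofReal_im_eq, map_add, map_sub, map_mul]
  have nx : x ≠ 0 := by rintro rfl; simp at hx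
  have ny : y ≠ 0 := by rintro rfl; simp at hy
  have nz : z ≠ 0 := by rintro rfl; simp at hz
  rw [← inv_eq_conj hx, ← inv_eq_conj hy, ← inv_eq_conj hz]
  have ha' : (a : ℂ) ≠ 0 := by exact_mod_cast ha.ne'
  have hb' : (b : ℂ) ≠ 0 := by exact_mod_cast hb.ne'
  have hI := I_sq
  rw [← sub_eq_zero]
  field_simp
  ring_nf
  simp only [hI]
  ring

theorem exists_ellipsePoint_eq {a b : ℝ} (ha : 0 < a) (hb : 0 < b) {P : Plane}
    (hP : P ∈ outerEllipse a b) : ∃ z : ℂ, ‖z‖ = 1 ∧ ellipsePoint a b z = P := by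
  refine ⟨⟨P 0 / a, P 1 / b⟩, ?_, ?_⟩
  · have h : (P 0 / a) ^ 2 + (P 1 / b) ^ 2 = 1 := hP
    rw [← sq_eq_sq₀ (norm_nonneg _) zero_le_one, ← normSq_eq_norm_sq, normSq_apply]
    linear_combination h
  · refine Plane.ext ?_ ?_ <;> simp [ellipsePoint] <;> field_simp

theorem sq_add_sq_of_norm_eq_one {z : ℂ} (hz : ‖z‖ = 1) : z.re ^ 2 + z.im ^ 2 = 1 := by
  have h : normSq z = 1 := by rw [normSq_eq_norm_sq, hz]; norm_num
  rw [normSq_apply] at h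
  linear_combination h

theorem ellipsePoint_mem_outerEllipse {a b : ℝ} (ha : 0 < a) (hb : 0 < b) {z : ℂ} (hz : ‖z‖ = 1) :
    ellipsePoint a b z ∈ outerEllipse a b := by
  show ((ellipsePoint a b z) 0 / a) ^ 2 + ((ellipsePoint a b z) 1 / b) ^ 2 = 1
  simp [ellipsePoint, ha.ne', hb.ne', sq_add_sq_of_norm_eq_one hz]

theorem ellipsePoint_injective {a b : ℝ} (ha : 0 < a) (hb : 0 < b) :
    Function.Injective (ellipsePoint a b) := by
  intro z w h
  have h0 := congrArg (fun P : Plane => P 0) h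
  have h1 := congrArg (fun P : Plane => P 1) h
  simp [ellipsePoint, ha.ne', hb.ne'] at h0 h1
  exact Complex.ext h0 h1

/-! ### Consequences of nesting -/

theorem lt_one_of_closedBall_subset {a b xc yc r : ℝ} (hr : 0 ≤ r)
    (hK : Metric.closedBall (!₂[xc, yc] : Plane) r ⊆ outerEllipseInterior a b) {x y : ℝ}
    (h : (x - xc) ^ 2 + (y - yc) ^ 2 ≤ r ^ 2) : (x / a) ^ 2 + (y / b) ^ 2 < 1 := by
  have hm : (!₂[x, y] : Plane) ∈ Metric.closedBall (!₂[xc, yc] : Plane) r := by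
    rw [Metric.mem_closedBall, ← sq_le_sq₀ dist_nonneg hr, Plane.dist_sq]
    simpa using h
  simpa [outerEllipseInterior] using hK hm

/-- No tangent line of the ellipse touches a circle nested in it. -/
theorem chordForm_self_ne_zero {a b xc yc r : ℝ} (ha : 0 < a) (hb : 0 < b) (hr : 0 < r)
    (hK : Metric.closedBall (!₂[xc, yc] : Plane) r ⊆ outerEllipseInterior a b) {z : ℂ}
    (hz : ‖z‖ = 1) :
    chordForm ⟨xc / a, yc / b⟩ (r ^ 2 / b ^ 2 - r ^ 2 / a ^ 2) (r ^ 2 / a ^ 2 + r ^ 2 / b ^ 2)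
      z z ≠ 0 := by
  intro h
  have hu := sq_add_sq_of_norm_eq_one hz
  have cz := mul_conj_self_of_norm_eq_one hz
  have nz : z ≠ 0 := by rintro rfl; simp at hz
  -- The tangent at `z` is `X / a * z.re + Y / b * z.im = 1`. `N` is the squared length of its
  -- normal vector and `t / √N` the signed distance from the center to it.
  set N : ℝ := (z.re / a) ^ 2 + (z.im / b) ^ 2 with hN
  set t : ℝ := 1 - (xc / a * z.re + yc / b * z.im) with ht
  have hNpos : 0 < N := by
    by_contra hneg
    have h1 : (z.re / a) ^ 2 = 0 := by nlinarith [sq_nonneg (z.re / a), sq_nonneg (z.im / b)]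
    have h2 : (z.im / b) ^ 2 = 0 := by nlinarith [sq_nonneg (z.re / a), sq_nonneg (z.im / b)]
    simp [ha.ne', hb.ne'] at h1 h2
    rw [h1, h2] at hu
    norm_num at hu
  have key : t ^ 2 = r ^ 2 * N := by
    have ha' : (a : ℂ) ≠ 0 := by exact_mod_cast ha.ne'
    have hb' : (b : ℂ) ≠ 0 := by exact_mod_cast hb.ne'
    have e : chordForm ⟨xc / a, yc / b⟩ (r ^ 2 / b ^ 2 - r ^ 2 / a ^ 2)
        (r ^ 2 / a ^ 2 + r ^ 2 / b ^ 2) z z = 4 * z ^ 2 * ((t ^ 2 - r ^ 2 * N : ℝ) : ℂ) := by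
      unfold chordForm
      rw [ht, hN]
      have hm : (⟨xc / a, yc / b⟩ : ℂ) = xc / a + yc / b * I := by
        apply Complex.ext <;> simp
      rw [hm]
      push_cast
      simp only [ofReal_re_eq, ofReal_im_eq, map_add, map_mul, map_div₀, conj_ofReal, conj_I]
      rw [← inv_eq_conj hz]
      have hI := I_sq
      rw [← sub_eq_zero]
      field_simp
      ring_nf
      simp only [hI]
      ring
    rw [e] at h
    have := (mul_eq_zero.1 h).resolve_left (by simp [nz])
    rw [ofReal_eq_zero] at this
    linarith
  -- The foot of the perpendicular from the center to the tangent lies in the closed disk, hence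
  -- strictly inside the ellipse; no point of a tangent does, by Cauchy–Schwarz.
  have hlt := lt_one_of_closedBall_subset hr.le hK (x := xc + t / N * (z.re / a))
    (y := yc + t / N * (z.im / b)) (le_of_eq (by
      have : (xc + t / N * (z.re / a) - xc) ^ 2 + (yc + t / N * (z.im / b) - yc) ^ 2 =
        (t / N) ^ 2 * N := by rw [hN]; ring
      rw [this, div_pow, key]; field_simp))
  have hone : (xc + t / N * (z.re / a)) / a * z.re + (yc + t / N * (z.im / b)) / b * z.im = 1 := by
    have : (xc + t / N * (z.re / a)) / a * z.re + (yc + t / N * (z.im / b)) / b * z.im =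
      (1 - t) + t / N * N := by rw [ht, hN]; ring
    rw [this, div_mul_cancel₀ _ hNpos.ne']; ring
  nlinarith [sq_nonneg ((xc + t / N * (z.re / a)) / a - z.re),
    sq_nonneg ((yc + t / N * (z.im / b)) / b - z.im)]

theorem circumcenter_eq_circumcenterPoint {a b : ℝ} (ha : 0 < a) (hb : 0 < b)
    (T : Affine.Triangle ℝ Plane) {z : Fin 3 → ℂ} (hz : ∀ i, ‖z i‖ = 1)
    (hT : ∀ i, T.points i = ellipsePoint a b (z i)) :
    T.circumcenter = circumcenterPoint a b (z 0 + z 1 + z 2) (z 0 * z 1 * z 2) := by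
  have htop : affineSpan ℝ (Set.range T.points) = ⊤ := by
    rw [T.independent.affineSpan_eq_top_iff_card_eq_finrank_add_one]
    simp
  refine (T.eq_circumcenter_of_dist_eq (by rw [htop]; trivial)
    (r := dist (ellipsePoint a b (z 0)) (circumcenterPoint a b (z 0 + z 1 + z 2)
      (z 0 * z 1 * z 2))) ?_).symm
  intro i
  rw [hT i]
  fin_cases i
  · rfl
  · exact (dist_circumcenterPoint_eq ha hb (hz 0) (hz 1) (hz 2)).symm
  · have h := dist_circumcenterPoint_eq ha hb (hz 2) (hz 0) (hz 1)
    rw [show z 2 + z 0 + z 1 = z 0 + z 1 + z 2 by ring,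
      show z 2 * z 0 * z 1 = z 0 * z 1 * z 2 by ring] at h
    exact h

/-! ### Poncelet's porism -/

/-- The vertices of a Poncelet triangle, in terms of their parameters. -/
theorem IsPonceletTriangle.exists_parameters {a b xc yc r : ℝ} (ha : 0 < a) (hb : 0 < b)
    (hr : 0 < r) {T : Affine.Triangle ℝ Plane} (hT : IsPonceletTriangle a b ⟨!₂[xc, yc], r⟩ T)
    {m : ℂ} {H k : ℝ} (hm : m = ⟨xc / a, yc / b⟩) (hH : H = r ^ 2 / b ^ 2 - r ^ 2 / a ^ 2)
    (hk : k = r ^ 2 / a ^ 2 + r ^ 2 / b ^ 2) :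
    (∃ l : ℂ, ‖l‖ = 1 ∧ T.circumcenter = circumcenterPoint a b (2 * m + conj (m ^ 2 + H) * l) l) ∧
      1 + (m ^ 2 + H) * conj (m ^ 2 + H) = 2 * k + 2 * (m * conj m) := by
  choose z hz hzT using fun i => exists_ellipsePoint_eq ha hb (hT.inscribed i)
  have hne : ∀ i j, i ≠ j → z i ≠ z j := by
    intro i j hij h
    apply hij
    apply T.independent.injective
    rw [← hzT i, ← hzT j, h]
  have hq : ∀ i j, i ≠ j → chordForm m H k (z i) (z j) = 0 := by
    intro i j hij
    have := hT.circumscribed i j hij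
    rw [← hzT i, ← hzT j] at this
    rw [hm, hH, hk]
    exact (isTangent_chord_iff ha hb hr (hz i) (hz j) (hne i j hij)).1 this
  obtain ⟨hs, hC⟩ := sum_eq_of_chordForm_eq_zero (hz 0) (hz 1) (hz 2) (hne 0 1 (by decide))
    (hne 0 2 (by decide)) (hne 1 2 (by decide)) (hq 0 1 (by decide)) (hq 0 2 (by decide))
    (hq 1 2 (by decide))
  refine ⟨⟨z 0 * z 1 * z 2, by simp [hz], ?_⟩, hC⟩
  rw [circumcenter_eq_circumcenterPoint ha hb T hz (fun i => (hzT i).symm), hs]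

/-- In the parametrization of the ellipse by the unit circle, the nested circle becomes an ellipse
with foci `m ± √H * I`, which lie in the unit disk. -/
theorem normSq_focus_lt_one {a b xc yc r : ℝ} (ha : 0 < a) (hb : 0 < b) (hr : 0 < r)
    (hK : Metric.closedBall (!₂[xc, yc] : Plane) r ⊆ outerEllipseInterior a b)
    {m : ℂ} {s : ℝ} (hm : m = ⟨xc / a, yc / b⟩) (hs : s ^ 2 = r ^ 2 / b ^ 2 - r ^ 2 / a ^ 2) :
    normSq (m + s * I) < 1 := by
  -- The point with parameter `m + s * I` is at distance `b * |s| ≤ r` from the center of the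
  -- caustic.
  have := lt_one_of_closedBall_subset hr.le hK (x := xc) (y := yc + b * s) (by
    have e : (xc - xc) ^ 2 + (yc + b * s - yc) ^ 2 = b ^ 2 * s ^ 2 := by ring
    have e' : b ^ 2 * (r ^ 2 / b ^ 2 - r ^ 2 / a ^ 2) = r ^ 2 - b ^ 2 * (r ^ 2 / a ^ 2) := by
      field_simp
    rw [e, hs, e']
    have : 0 ≤ b ^ 2 * (r ^ 2 / a ^ 2) := by positivity
    linarith)
  rw [normSq_apply, hm]
  simp
  convert! this using 1
  field_simp

/-- Poncelet's porism for triangles with a circular caustic. -/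
theorem exists_isPonceletTriangle {a b xc yc r : ℝ} (hb : 0 < b) (hab : b < a) (hr : 0 < r)
    (hK : Metric.closedBall (!₂[xc, yc] : Plane) r ⊆ outerEllipseInterior a b)
    {m : ℂ} {H k : ℝ} (hm : m = ⟨xc / a, yc / b⟩) (hH : H = r ^ 2 / b ^ 2 - r ^ 2 / a ^ 2)
    (hk : k = r ^ 2 / a ^ 2 + r ^ 2 / b ^ 2)
    (hC : 1 + (m ^ 2 + H) * conj (m ^ 2 + H) = 2 * k + 2 * (m * conj m)) {l : ℂ} (hl : ‖l‖ = 1) :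
    ∃ T : Affine.Triangle ℝ Plane, IsPonceletTriangle a b ⟨!₂[xc, yc], r⟩ T ∧
      T.circumcenter = circumcenterPoint a b (2 * m + conj (m ^ 2 + H) * l) l := by
  have ha : 0 < a := hb.trans hab
  have hH0 : 0 ≤ H := by
    rw [hH, sub_nonneg]; gcongr
  obtain ⟨h, hh⟩ : ∃ h : ℝ, h ^ 2 = H := ⟨√H, Real.sq_sqrt hH0⟩
  have hfoc : ∀ s : ℝ, s ^ 2 = H → normSq (m + s * I) < 1 :=
    fun s hs => normSq_focus_lt_one ha hb hr hK hm (hs.trans hH)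
  have hf := hfoc h hh
  have hg := hfoc (-h) (by rw [neg_sq, hh])
  -- This cubic is the Blaschke equation with denominators cleared, for the foci `m ± h * I` with
  -- sum `2 * m` and product `m ^ 2 + H`.
  obtain ⟨x, y, z, hxyz⟩ := exists_roots_of_cubic (-(2 * m + conj (m ^ 2 + H) * l))
    (m ^ 2 + H + 2 * conj m * l) (-l)
  have hHc : (H : ℂ) = h ^ 2 := by rw [← hh]; push_cast; rfl
  have hunit : ∀ w, (w - x) * (w - y) * (w - z) = 0 → ‖w‖ = 1 := by
    intro w hw
    rw [← hxyz] at hw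
    refine norm_eq_one_of_blaschke hf hg hl ?_
    have hvc : conj (m ^ 2 + H) = conj m ^ 2 + H := by simp
    rw [hvc] at hw
    simp only [map_add, map_mul, conj_ofReal, conj_I]
    push_cast
    rw [hHc] at hw
    linear_combination hw + (-w * h ^ 2 + l * h ^ 2 * w ^ 2) * I_sq
  have hx : ‖x‖ = 1 := hunit x (by ring)
  have hy : ‖y‖ = 1 := hunit y (by ring)
  have hz : ‖z‖ = 1 := hunit z (by ring)
  -- Vieta's formulas, read off from the values at 0, 1 and -1.
  have hprod : x * y * z = l := by linear_combination hxyz 0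
  have hsum : x + y + z = 2 * m + conj (m ^ 2 + H) * l := by
    linear_combination (hxyz 1 + hxyz (-1)) / 2 - hxyz 0
  have hcub : ∀ w, (w - x) * (w - y) * (w - z) = 0 → w ^ 3 - (2 * m + conj (m ^ 2 + H) * l) * w ^ 2 +
      (m ^ 2 + H + 2 * conj m * l) * w - l = 0 := by
    intro w hw; rw [← hw, ← hxyz]; ring
  have nx : x ≠ 0 := by rintro rfl; simp at hx
  have ny : y ≠ 0 := by rintro rfl; simp at hy
  have nz : z ≠ 0 := by rintro rfl; simp at hz
  have qxy : chordForm m H k x y = 0 :=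
    chordForm_eq_zero_of_sum_eq nz hsum hprod (hcub z (by ring)) hC
  have qxz : chordForm m H k x z = 0 :=
    chordForm_eq_zero_of_sum_eq ny (by rw [← hsum]; ring) (by rw [← hprod]; ring)
      (hcub y (by ring)) hC
  have qyz : chordForm m H k y z = 0 :=
    chordForm_eq_zero_of_sum_eq nx (by rw [← hsum]; ring) (by rw [← hprod]; ring)
      (hcub x (by ring)) hC
  have hself : ∀ w, ‖w‖ = 1 → chordForm m H k w w ≠ 0 := by
    intro w hw; rw [hm, hH, hk]; exact chordForm_self_ne_zero ha hb hr hK hw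
  have hxy : x ≠ y := by rintro rfl; exact hself x hx qxy
  have hxz : x ≠ z := by rintro rfl; exact hself x hx qxz
  have hyz : y ≠ z := by rintro rfl; exact hself y hy qyz
  have hinj := ellipsePoint_injective ha hb
  have hcos : EuclideanGeometry.Cospherical
      ({ellipsePoint a b x, ellipsePoint a b y, ellipsePoint a b z} : Set Plane) := by
    refine ⟨circumcenterPoint a b (x + y + z) (x * y * z),
      dist (ellipsePoint a b x) (circumcenterPoint a b (x + y + z) (x * y * z)), ?_⟩
    rintro p (rfl | rfl | rfl)
    · rfl
    · exact (dist_circumcenterPoint_eq ha hb hx hy hz).symm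
    · have h := dist_circumcenterPoint_eq ha hb hz hx hy
      rwa [show z + x + y = x + y + z by ring, show z * x * y = x * y * z by ring] at h
  let T : Affine.Triangle ℝ Plane := ⟨![ellipsePoint a b x, ellipsePoint a b y, ellipsePoint a b z],
    hcos.affineIndependent_of_ne (hinj.ne hxy) (hinj.ne hxz) (hinj.ne hyz)⟩
  have hu : ∀ i, ‖(![x, y, z] : Fin 3 → ℂ) i‖ = 1 := by
    intro i; fin_cases i <;> assumption
  have hTp : ∀ i, T.points i = ellipsePoint a b ((![x, y, z] : Fin 3 → ℂ) i) := by
    intro i; fin_cases i <;> rfl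
  refine ⟨T, ⟨fun i => ?_, fun i j hij => ?_⟩, ?_⟩
  · rw [hTp]; exact ellipsePoint_mem_outerEllipse ha hb (hu i)
  · rw [hTp, hTp]
    have hq : ∀ i j, i ≠ j → chordForm m H k ((![x, y, z] : Fin 3 → ℂ) i)
        ((![x, y, z] : Fin 3 → ℂ) j) = 0 := by
      intro i j hij
      fin_cases i <;> fin_cases j <;> first
        | exact absurd rfl hij
        | assumption
        | (rw [chordForm_comm]; assumption)
    have hqij := hq i j hij
    have hne : (![x, y, z] : Fin 3 → ℂ) i ≠ (![x, y, z] : Fin 3 → ℂ) j := by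
      intro he; rw [he] at hqij; exact hself _ (hu j) hqij
    refine (isTangent_chord_iff ha hb hr (hu i) (hu j) hne).2 ?_
    rw [← hm, ← hH, ← hk]; exact hqij
  · rw [circumcenter_eq_circumcenterPoint ha hb T hu hTp, ← hsum, ← hprod]
    rfl

/-! ### Ellipses as real-linear images of the unit circle -/

/-- The image of the unit circle under the real linear map `l ↦ α * l + β * conj l` is an ellipse
with foci the square roots of `4 * α * β`. -/
theorem norm_sub_add_norm_add_eq_iff {α β φ W : ℂ} (hαβ : ‖β‖ < ‖α‖) (hφ : φ ^ 2 = 4 * α * β) :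
    ‖W - φ‖ + ‖W + φ‖ = 2 * (‖α‖ + ‖β‖) ↔ ∃ l : ℂ, ‖l‖ = 1 ∧ W = α * l + β * conj l := by
  constructor
  · intro h
    have hA : α * conj α = (‖α‖ : ℂ) ^ 2 := Complex.mul_conj' α
    have hB : β * conj β = (‖β‖ : ℂ) ^ 2 := Complex.mul_conj' β
    have hφφ : φ * conj φ = 4 * ‖α‖ * ‖β‖ := by
      have e := congrArg norm hφ
      rw [norm_pow, norm_mul, norm_mul] at e
      rw [Complex.mul_conj']
      have e4 : ‖(4 : ℂ)‖ = 4 := by norm_num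
      rw [e4] at e
      exact_mod_cast e
    have hφc : conj φ ^ 2 = 4 * conj α * conj β := by
      have := congrArg conj hφ
      simpa [Complex.conj_ofNat] using this
    obtain ⟨A, hA'⟩ : ∃ A, A = ‖α‖ := ⟨_, rfl⟩
    obtain ⟨B, hB', hB0⟩ : ∃ B, B = ‖β‖ ∧ 0 ≤ B := ⟨_, rfl, norm_nonneg _⟩
    rw [← hA', ← hB'] at h hαβ hφφ
    rw [← hA'] at hA
    rw [← hB'] at hB
    have hD : A ^ 2 - B ^ 2 ≠ 0 := by nlinarith
    have hD' : (A : ℂ) ^ 2 - (B : ℂ) ^ 2 ≠ 0 := by exact_mod_cast hD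
    -- Cramer's rule for `W = α * l + β * conj l` and its conjugate.
    set l : ℂ := (conj α * W - β * conj W) / (A ^ 2 - B ^ 2) with hl
    have hW : W = α * l + β * conj l := by
      rw [hl]
      simp only [map_div₀, map_sub, map_mul, conj_conj, map_pow, conj_ofReal]
      field_simp
      linear_combination -W * hA + W * hB
    refine ⟨l, ?_, hW⟩
    have hWc : conj W = conj α * conj l + conj β * l := by
      have := congrArg conj hW
      simpa using this
    -- The bifocal equation with its square roots eliminated.
    have hquad : (A + B) ^ 2 * (‖W‖ ^ 2 + ‖φ‖ ^ 2) = (A + B) ^ 4 + (W * conj φ).re ^ 2 := by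
      have h1 : ‖W - φ‖ ^ 2 = ‖W‖ ^ 2 + ‖φ‖ ^ 2 - 2 * (W * conj φ).re := by
        simp only [← normSq_eq_norm_sq]; exact normSq_sub _ _
      have h2 : ‖W + φ‖ ^ 2 = ‖W‖ ^ 2 + ‖φ‖ ^ 2 + 2 * (W * conj φ).re := by
        simp only [← normSq_eq_norm_sq]; exact normSq_add _ _
      have h3 : ‖W + φ‖ = 2 * (A + B) - ‖W - φ‖ := by linarith
      rw [h3] at h2
      have h4 : (A + B) * ‖W - φ‖ = (A + B) ^ 2 - (W * conj φ).re := by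
        linear_combination (h1 - h2) / 4
      have h5 : ((A + B) * ‖W - φ‖) ^ 2 = ((A + B) ^ 2 - (W * conj φ).re) ^ 2 := by rw [h4]
      linear_combination h5 - (A + B) ^ 2 * h1
    have hre : (((W * conj φ).re : ℝ) : ℂ) ^ 2 =
        W ^ 2 * conj α * conj β + conj W ^ 2 * α * β + 2 * (W * conj W) * A * B := by
      rw [ofReal_re_eq]
      simp only [map_mul, conj_conj]
      linear_combination W ^ 2 / 4 * hφc + conj W ^ 2 / 4 * hφ + W * conj W / 2 * hφφ
    have hquad' : ((A : ℂ) + B) ^ 2 * (W * conj W + φ * conj φ) =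
        (A + B) ^ 4 + (((W * conj φ).re : ℝ) : ℂ) ^ 2 := by
      rw [Complex.mul_conj', Complex.mul_conj']; exact_mod_cast hquad
    rw [hre, hφφ] at hquad'
    have hfin : ((A : ℂ) ^ 2 - B ^ 2) ^ 2 * (l * conj l - 1) = 0 := by
      rw [hWc] at hquad'
      generalize conj l = l' at *
      rw [hW] at hquad'
      linear_combination hquad' +
        ((α * l + β * l') * (conj α * l' + conj β * l) -
          (A ^ 2 - B ^ 2 + α * conj α - β * conj β) * (l * l')) * hA +
        ((α * l + β * l') * (conj α * l' + conj β * l) +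
          (A ^ 2 - B ^ 2 + α * conj α - β * conj β) * (l * l')) * hB
    have h1 := (mul_eq_zero.1 hfin).resolve_left (pow_ne_zero _ hD')
    rw [sub_eq_zero, Complex.mul_conj'] at h1
    have h2 : ‖l‖ ^ 2 = 1 := by exact_mod_cast h1
    nlinarith [norm_nonneg l]
  · rintro ⟨l, hl, rfl⟩
    -- With `α = σ ^ 2`, `β = τ ^ 2`, `l = μ ^ 2` and the sign of `τ` adjusted so that `φ = 2 * σ *
    -- τ`, both `W ∓ φ` are the squares `(σ * μ ∓ τ * conj μ) ^ 2`. The parallelogram law then gives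
    -- the sum of their norms.
    obtain ⟨σ, rfl⟩ := IsAlgClosed.exists_pow_nat_eq α two_pos
    obtain ⟨μ, rfl⟩ := IsAlgClosed.exists_pow_nat_eq l two_pos
    obtain ⟨τ, rfl, hτ⟩ : ∃ τ, τ ^ 2 = β ∧ φ = 2 * σ * τ := by
      obtain ⟨τ, rfl⟩ := IsAlgClosed.exists_pow_nat_eq β two_pos
      have : φ ^ 2 = (2 * σ * τ) ^ 2 := by rw [hφ]; ring
      rcases sq_eq_sq_iff_eq_or_eq_neg.1 this with h | h
      · exact ⟨τ, rfl, h⟩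
      · exact ⟨-τ, by ring, by rw [h]; ring⟩
    have hμ : ‖μ‖ = 1 := by
      rw [norm_pow] at hl; nlinarith [norm_nonneg μ]
    have c := mul_conj_self_of_norm_eq_one hμ
    have e₁ : σ ^ 2 * μ ^ 2 + τ ^ 2 * conj (μ ^ 2) - φ = (σ * μ - τ * conj μ) ^ 2 := by
      rw [hτ, map_pow]; linear_combination 2 * σ * τ * c
    have e₂ : σ ^ 2 * μ ^ 2 + τ ^ 2 * conj (μ ^ 2) + φ = (σ * μ + τ * conj μ) ^ 2 := by
      rw [hτ, map_pow]; linear_combination -2 * σ * τ * c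
    have hp := parallelogram_law_with_norm ℝ (σ * μ) (τ * conj μ)
    rw [norm_mul, norm_mul, RCLike.norm_conj, hμ] at hp
    rw [e₁, e₂]
    simp only [norm_pow]
    linear_combination hp

/-! ### Explicit foci and semi-axes -/

/-- The radius of the caustic (encoded in `H`) in terms of `D = √(1 + c² y² / b²)` and
`D' = √(1 - c² x² / a²)`, where `(x, y)` is the parameter of the center of the caustic. -/
theorem caustic_relation {a b x y H k D D' : ℝ} (hb : 0 < b) (hab : b < a) (hD : 0 ≤ D)
    (hD' : 0 ≤ D') (hDsq : b ^ 2 * D ^ 2 = b ^ 2 + (a ^ 2 - b ^ 2) * y ^ 2)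
    (hDsq' : a ^ 2 * D' ^ 2 = a ^ 2 - (a ^ 2 - b ^ 2) * x ^ 2)
    (hHk : (a ^ 2 - b ^ 2) * k = H * (a ^ 2 + b ^ 2)) (hH : H < 1 - x ^ 2 - y ^ 2)
    (hC : 1 + ((x ^ 2 - y ^ 2 + H) ^ 2 + (2 * x * y) ^ 2) = 2 * k + 2 * (x ^ 2 + y ^ 2)) :
    2 * a * b * (D * D') = a ^ 2 + b ^ 2 - (a ^ 2 - b ^ 2) * (x ^ 2 - y ^ 2 + H) := by
  have hc : 0 < a ^ 2 - b ^ 2 := by nlinarith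
  -- The closing condition is quadratic in `H` and only determines the square of this quantity; the
  -- bound on `H` from nesting fixes the sign.
  have hpos : 0 ≤ a ^ 2 + b ^ 2 - (a ^ 2 - b ^ 2) * (x ^ 2 - y ^ 2 + H) := by
    nlinarith [mul_nonneg hc.le (sq_nonneg y), sq_nonneg b]
  have ha : 0 < a := hb.trans hab
  rw [← sq_eq_sq₀ (by positivity) hpos]
  linear_combination (4 * a ^ 2 * D' ^ 2) * hDsq + 4 * (b ^ 2 + (a ^ 2 - b ^ 2) * y ^ 2) * hDsq' -
    (a ^ 2 - b ^ 2) ^ 2 * hC - 2 * (a ^ 2 - b ^ 2) * hHk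

theorem Plane.dist_eq_norm (P Q : Plane) :
    dist P Q = ‖(⟨P 0, P 1⟩ : ℂ) - ⟨Q 0, Q 1⟩‖ := by
  rw [← sq_eq_sq₀ dist_nonneg (norm_nonneg _), Plane.dist_sq, ← normSq_eq_norm_sq, normSq_apply]
  simp; ring

/-- A single Poncelet triangle yields the closing condition, which is independent of `l`; therefore
every unimodular `l` occurs. -/
theorem circumcenterLocus_eq {a b xc yc r : ℝ} (hb : 0 < b) (hab : b < a)
    (hK : IsCircularCaustic a b ⟨!₂[xc, yc], r⟩) {m : ℂ} {H : ℝ} (hm : m = ⟨xc / a, yc / b⟩)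
    (hH : H = r ^ 2 / b ^ 2 - r ^ 2 / a ^ 2) :
    circumcenterLocus a b ⟨!₂[xc, yc], r⟩ =
      {P | ∃ l : ℂ, ‖l‖ = 1 ∧ P = circumcenterPoint a b (2 * m + conj (m ^ 2 + H) * l) l} := by
  have ha : 0 < a := hb.trans hab
  obtain ⟨T, hT⟩ := hK.closes
  have hC := (hT.exists_parameters ha hb hK.radius_pos hm hH rfl).2
  ext P
  constructor
  · rintro ⟨T', hT', rfl⟩
    exact (hT'.exists_parameters ha hb hK.radius_pos hm hH rfl).1
  · rintro ⟨l, hl, rfl⟩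
    exact exists_isPonceletTriangle hb hab hK.radius_pos hK.nested hm hH rfl hC hl

/-- The coefficient of `l` in the parametrization of the locus of the circumcenter by the unit
circle. -/
noncomputable def locusCoeff (a b x y H : ℝ) : ℂ :=
  ⟨(a ^ 2 - b ^ 2) / (8 * a * b) * (a + b - (x ^ 2 - y ^ 2 + H) * (a - b)),
    (a ^ 2 - b ^ 2) / (8 * a * b) * (2 * x * y * (a - b))⟩

/-- The coefficient of `conj l` in the parametrization of the locus of the circumcenter by the unit
circle. -/
noncomputable def locusConjCoeff (a b x y H : ℝ) : ℂ :=
  ⟨(a ^ 2 - b ^ 2) / (8 * a * b) * ((x ^ 2 - y ^ 2 + H) * (a + b) - (a - b)),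
    (a ^ 2 - b ^ 2) / (8 * a * b) * (2 * x * y * (a + b))⟩

theorem circumcenterPoint_eq {a b : ℝ} (ha : a ≠ 0) (hb : b ≠ 0) (x y H : ℝ) {m : ℂ}
    (hm : m = ⟨x, y⟩) (l : ℂ) :
    (⟨(circumcenterPoint a b (2 * m + conj (m ^ 2 + H) * l) l) 0,
      (circumcenterPoint a b (2 * m + conj (m ^ 2 + H) * l) l) 1⟩ : ℂ) =
      ⟨(a ^ 2 - b ^ 2) / 2 * (x / a), -((a ^ 2 - b ^ 2) / 2 * (y / b))⟩ +
        (locusCoeff a b x y H * l + locusConjCoeff a b x y H * conj l) := by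
  rw [hm]
  apply Complex.ext <;>
    simp [circumcenterPoint, locusCoeff, locusConjCoeff, pow_two] <;> field_simp <;> ring

/-- The closing condition eliminates `‖m ^ 2 + H‖ ^ 2` from `‖α‖ ^ 2`, and `hDD` turns the rest into
a perfect square. -/
theorem norm_locusCoeff {a b x y H k D D' : ℝ} (hb : 0 < b) (hab : b < a) (hD : 0 ≤ D)
    (hD' : 0 ≤ D') (hDsq : b ^ 2 * D ^ 2 = b ^ 2 + (a ^ 2 - b ^ 2) * y ^ 2)
    (hDsq' : a ^ 2 * D' ^ 2 = a ^ 2 - (a ^ 2 - b ^ 2) * x ^ 2)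
    (hHk : (a ^ 2 - b ^ 2) * k = H * (a ^ 2 + b ^ 2))
    (hC : 1 + ((x ^ 2 - y ^ 2 + H) ^ 2 + (2 * x * y) ^ 2) = 2 * k + 2 * (x ^ 2 + y ^ 2))
    (hDD : 2 * a * b * (D * D') = a ^ 2 + b ^ 2 - (a ^ 2 - b ^ 2) * (x ^ 2 - y ^ 2 + H)) :
    ‖locusCoeff a b x y H‖ = (a - b) * (D + D') / 4 := by
  have ha : 0 < a := hb.trans hab
  rw [← sq_eq_sq₀ (norm_nonneg _) (by have := sub_pos.2 hab; positivity), ← normSq_eq_norm_sq,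
    normSq_apply, locusCoeff]
  field_simp
  linear_combination 16 * (a - b) ^ 2 * ((a ^ 2 - b ^ 2) ^ 2 * hC + 2 * (a ^ 2 - b ^ 2) * hHk -
    4 * a ^ 2 * hDsq - 4 * b ^ 2 * hDsq' - 4 * a * b * hDD)

theorem norm_locusConjCoeff {a b x y H k D D' : ℝ} (ha : 0 < a) (hb : 0 < b) (hDle : D' ≤ D)
    (hDsq : b ^ 2 * D ^ 2 = b ^ 2 + (a ^ 2 - b ^ 2) * y ^ 2)
    (hDsq' : a ^ 2 * D' ^ 2 = a ^ 2 - (a ^ 2 - b ^ 2) * x ^ 2)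
    (hHk : (a ^ 2 - b ^ 2) * k = H * (a ^ 2 + b ^ 2))
    (hC : 1 + ((x ^ 2 - y ^ 2 + H) ^ 2 + (2 * x * y) ^ 2) = 2 * k + 2 * (x ^ 2 + y ^ 2))
    (hDD : 2 * a * b * (D * D') = a ^ 2 + b ^ 2 - (a ^ 2 - b ^ 2) * (x ^ 2 - y ^ 2 + H)) :
    ‖locusConjCoeff a b x y H‖ = (a + b) * (D - D') / 4 := by
  rw [← sq_eq_sq₀ (norm_nonneg _) (by have := sub_nonneg.2 hDle; positivity),
    ← normSq_eq_norm_sq, normSq_apply, locusConjCoeff]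
  field_simp
  linear_combination 16 * (a + b) ^ 2 * ((a ^ 2 - b ^ 2) ^ 2 * hC + 2 * (a ^ 2 - b ^ 2) * hHk -
    4 * a ^ 2 * hDsq - 4 * b ^ 2 * hDsq' + 4 * a * b * hDD)

/-- The squared modulus of `m ^ 2 + H` enters only the real part of the product, where the closing
condition removes it; the imaginary part is an identity. -/
theorem locusFocus_sq {a b x y H k : ℝ} (ha : a ≠ 0) (hb : b ≠ 0)
    (hHk : (a ^ 2 - b ^ 2) * k = H * (a ^ 2 + b ^ 2))
    (hC : 1 + ((x ^ 2 - y ^ 2 + H) ^ 2 + (2 * x * y) ^ 2) = 2 * k + 2 * (x ^ 2 + y ^ 2)) :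
    (⟨(a ^ 2 - b ^ 2) / 2 * (x / a), (a ^ 2 - b ^ 2) / 2 * (y / b)⟩ : ℂ) ^ 2 =
      4 * locusCoeff a b x y H * locusConjCoeff a b x y H := by
  rw [locusCoeff, locusConjCoeff]
  apply Complex.ext
  · simp [pow_two]
    field_simp
    linear_combination 16 * (a ^ 2 - b ^ 2) ^ 3 * hC + 32 * (a ^ 2 - b ^ 2) ^ 2 * hHk
  · simp [pow_two]
    field_simp
    ring

/-- The foci and semi-axes of the ellipse traced by the circumcenter, in terms of the parameter
`(x, y)` of the center of the caustic. -/
theorem isEllipseWith_circumcenterLocus {a b xc yc r x y D D' p q : ℝ} {F F' : Plane} (hb : 0 < b)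
    (hab : b < a) (hK : IsCircularCaustic a b ⟨!₂[xc, yc], r⟩) (hxc : xc = a * x) (hyc : yc = b * y)
    (hD : 0 ≤ D) (hD' : 0 ≤ D') (hDsq : b ^ 2 * D ^ 2 = b ^ 2 + (a ^ 2 - b ^ 2) * y ^ 2)
    (hDsq' : a ^ 2 * D' ^ 2 = a ^ 2 - (a ^ 2 - b ^ 2) * x ^ 2)
    (hp : p = (a * D - b * D') / 2) (hq : q = (a * D' - b * D) / 2)
    (hF : F = !₂[xc * (1 - (b / a) ^ 2), 0]) (hF' : F' = !₂[0, yc * (1 - (a / b) ^ 2)]) :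
    IsEllipseWith (circumcenterLocus a b ⟨!₂[xc, yc], r⟩) F F' p q := by
  have ha : 0 < a := hb.trans hab
  have hr : 0 < r := hK.radius_pos
  have hc2 : 0 < a ^ 2 - b ^ 2 := by nlinarith
  obtain ⟨H, hH⟩ : ∃ H, H = r ^ 2 / b ^ 2 - r ^ 2 / a ^ 2 := ⟨_, rfl⟩
  obtain ⟨k, hk⟩ : ∃ k, k = r ^ 2 / a ^ 2 + r ^ 2 / b ^ 2 := ⟨_, rfl⟩
  have hHk : (a ^ 2 - b ^ 2) * k = H * (a ^ 2 + b ^ 2) := by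
    rw [hH, hk]; field_simp
    ring
  have hH0 : 0 ≤ H := by rw [hH, sub_nonneg]; gcongr
  have hm : (⟨x, y⟩ : ℂ) = ⟨xc / a, yc / b⟩ := by
    rw [hxc, hyc, mul_div_cancel_left₀ _ ha.ne', mul_div_cancel_left₀ _ hb.ne']
  -- Averaging the bounds for the two foci gives `normSq m + H < 1`.
  have hHlt : H < 1 - x ^ 2 - y ^ 2 := by
    have hs : √H ^ 2 = H := Real.sq_sqrt hH0
    have h₁ := normSq_focus_lt_one ha hb hr hK.nested hm (hs.trans hH)
    have h₂ := normSq_focus_lt_one ha hb hr hK.nested hm (s := -√H) (by rw [neg_sq, hs, hH])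
    rw [normSq_apply] at h₁ h₂
    simp at h₁ h₂
    nlinarith
  have hC : 1 + ((x ^ 2 - y ^ 2 + H) ^ 2 + (2 * x * y) ^ 2) = 2 * k + 2 * (x ^ 2 + y ^ 2) := by
    obtain ⟨T, hT⟩ := hK.closes
    have h := congrArg re (hT.exists_parameters ha hb hr hm hH hk).2
    simp [pow_two] at h
    linear_combination h
  have hDD := caustic_relation hb hab hD hD' hDsq hDsq' hHk hHlt hC
  have hDle : D' ≤ D := by
    have h₁ : 1 ≤ D ^ 2 := by nlinarith [mul_nonneg hc2.le (sq_nonneg y), pow_pos hb 2]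
    have h₂ : D' ^ 2 ≤ 1 := by nlinarith [mul_nonneg hc2.le (sq_nonneg x), pow_pos ha 2]
    nlinarith
  -- Here `(a * D') ^ 2 - (b * D) ^ 2 = (a ^ 2 - b ^ 2) * (1 - x ^ 2 - y ^ 2)`.
  have hqpos : 0 < q := by
    have h₁ : 0 < (a ^ 2 - b ^ 2) * (1 - x ^ 2 - y ^ 2) := mul_pos hc2 (by linarith)
    have h₂ : (b * D) ^ 2 < (a * D') ^ 2 := by
      rw [mul_pow, mul_pow, hDsq, hDsq']; linarith
    have := lt_of_pow_lt_pow_left₀ 2 (by positivity) h₂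
    rw [hq]; linarith
  have hnα := norm_locusCoeff hb hab hD hD' hDsq hDsq' hHk hC hDD
  have hnβ := norm_locusConjCoeff ha hb hDle hDsq hDsq' hHk hC hDD
  have hφsq := locusFocus_sq ha.ne' hb.ne' hHk hC
  have hpoint := circumcenterPoint_eq ha.ne' hb.ne' x y H rfl
  generalize hφ : (⟨(a ^ 2 - b ^ 2) / 2 * (x / a), (a ^ 2 - b ^ 2) / 2 * (y / b)⟩ : ℂ) = φ at hφsq
  generalize hO : (⟨(a ^ 2 - b ^ 2) / 2 * (x / a), -((a ^ 2 - b ^ 2) / 2 * (y / b))⟩ : ℂ) = O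
    at hpoint
  generalize locusCoeff a b x y H = α at *
  generalize locusConjCoeff a b x y H = β at *
  have hpsum : p = ‖α‖ + ‖β‖ := by rw [hp, hnα, hnβ]; ring
  have hqdiff : q = ‖α‖ - ‖β‖ := by rw [hq, hnα, hnβ]; ring
  have hnφ : ‖φ‖ ^ 2 = 4 * ‖α‖ * ‖β‖ := by
    have := congrArg norm hφsq
    rwa [norm_pow, norm_mul, norm_mul, show ‖(4 : ℂ)‖ = 4 by norm_num] at this
  -- `O` and `φ` are complex conjugates, so `O + φ` is real and `O - φ` purely imaginary.
  have hFO : (⟨F 0, F 1⟩ : ℂ) = O + φ := by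
    rw [hF, ← hO, ← hφ, hxc]
    apply Complex.ext <;> simp
    field_simp
    ring
  have hFO' : (⟨F' 0, F' 1⟩ : ℂ) = O - φ := by
    rw [hF', ← hO, ← hφ, hyc]
    apply Complex.ext <;> simp
    field_simp
    ring
  refine ⟨hqpos, ?_, ?_, ?_⟩
  · rw [hpsum, hqdiff]; linarith [norm_nonneg β]
  · rw [Plane.dist_eq_norm, hFO, hFO', show O + φ - (O - φ) = 2 * φ by ring, norm_mul,
      show ‖(2 : ℂ)‖ = 2 by norm_num, hpsum, hqdiff]
    linear_combination hnφ
  · rw [circumcenterLocus_eq hb hab hK hm hH]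
    ext P
    have hiff := norm_sub_add_norm_add_eq_iff (W := (⟨P 0, P 1⟩ : ℂ) - O) (α := α) (β := β)
      (by linarith) hφsq
    simp only [Set.mem_ofPred_eq]
    rw [Plane.dist_eq_norm, Plane.dist_eq_norm, hFO, hFO', hpsum, ← sub_sub, sub_sub_eq_add_sub,
      add_sub_right_comm, hiff]
    refine exists_congr fun l => and_congr_right fun _ => ?_
    constructor
    · rintro rfl
      rw [hpoint]; ring
    · intro h
      have h' := (sub_eq_iff_eq_add'.1 h).trans (hpoint l).symm
      exact Plane.ext (congrArg re h') (congrArg im h')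

theorem mainTheorem2 (a b : ℝ) (hb : 0 < b) (hab : b < a)
    (xc yc r : ℝ) (hK : IsCircularCaustic a b ⟨!₂[xc, yc], r⟩)
    (c δ₃ δ₃' a₃ b₃ : ℝ) (F₃ F₃' : Plane)
    (hc : c = √(a ^ 2 - b ^ 2))
    (hδ₃ : δ₃ = √(b ^ 4 + c ^ 2 * yc ^ 2) / (2 * b))
    (hδ₃' : δ₃' = √(a ^ 4 - c ^ 2 * xc ^ 2) / (2 * a))
    (ha₃ : a₃ = δ₃ * (a / b) - δ₃' * (b / a))
    (hb₃ : b₃ = δ₃' - δ₃)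
    (hF₃ : F₃ = !₂[xc * (1 - (b / a) ^ 2), 0])
    (hF₃' : F₃' = !₂[0, yc * (1 - (a / b) ^ 2)]) :
    IsEllipseWith (circumcenterLocus a b ⟨!₂[xc, yc], r⟩) F₃ F₃' a₃ b₃ ∧
      Collinear ℝ {F₃, F₃', !₂[xc, yc]} := by
  have ha : 0 < a := hb.trans hab
  have hc2 : 0 < a ^ 2 - b ^ 2 := by nlinarith
  have hcsq : c ^ 2 = a ^ 2 - b ^ 2 := by rw [hc, Real.sq_sqrt hc2.le]
  constructor
  · obtain ⟨x, hx⟩ : ∃ x, x = xc / a := ⟨_, rfl⟩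
    obtain ⟨y, hy⟩ : ∃ y, y = yc / b := ⟨_, rfl⟩
    have hxc : xc = a * x := by rw [hx]; field_simp
    have hyc : yc = b * y := by rw [hy]; field_simp
    have hin : 0 ≤ a ^ 4 - c ^ 2 * xc ^ 2 := by
      have hlt := lt_one_of_closedBall_subset hK.radius_pos.le hK.nested (x := xc) (y := yc)
        (by simpa using sq_nonneg r)
      rw [← hx, ← hy] at hlt
      have hxlt : x ^ 2 ≤ 1 := by linarith [sq_nonneg y]
      have h := mul_le_mul_of_nonneg_left hxlt hc2.le
      have e : a ^ 4 - c ^ 2 * xc ^ 2 = a ^ 2 * (a ^ 2 - (a ^ 2 - b ^ 2) * x ^ 2) := by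
        rw [hcsq, hxc]; ring
      rw [e]
      exact mul_nonneg (sq_nonneg a) (by linarith [sq_nonneg b])
    -- The normalization is `δ₃ = b * D / 2` and `δ₃' = a * D' / 2`.
    refine isEllipseWith_circumcenterLocus hb hab hK hxc hyc
      (D := √(b ^ 4 + c ^ 2 * yc ^ 2) / b ^ 2) (D' := √(a ^ 4 - c ^ 2 * xc ^ 2) / a ^ 2)
      (by positivity) (by positivity) ?_ ?_ ?_ ?_ hF₃ hF₃'
    · rw [div_pow, Real.sq_sqrt (by positivity), hcsq, hyc]; field_simp
    · rw [div_pow, Real.sq_sqrt hin, hcsq, hxc]; field_simp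
    · rw [ha₃, hδ₃, hδ₃']; field_simp
    · rw [hb₃, hδ₃, hδ₃']; field_simp
  · have hmem : (!₂[xc, yc] : Plane) ∈ line[ℝ, F₃, F₃'] := by
      rw [mem_affineSpan_pair_iff_exists_lineMap_eq]
      -- The parameter solves `(1 - t) * (1 - (b / a) ^ 2) = 1`, and then also `t * (1 - (a / b) ^
      -- 2) = 1`.
      refine ⟨-(b ^ 2 / (a ^ 2 - b ^ 2)), ?_⟩
      rw [hF₃, hF₃']
      refine Plane.ext ?_ ?_ <;> simp [AffineMap.lineMap_apply] <;> field_simp <;> ring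
    have := collinear_insert_of_mem_affineSpan_pair hmem
    convert! this using 1
    ext P
    simp only [Set.mem_insert_iff, Set.mem_singleton_iff]
    tauto
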